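/- All graphs are finite, simple and undirected; $N(v)$ is the neighbourhood of $v$, and $G[U]$ is the subgraph of $G$ induced by $U$. A set $M\subseteq V_G$ is a *module* (homogeneous set) of $G$ if $N(u)\setminus M=N(w)\setminus M$ for all $u,w\in M$. A graph $G$ with $n$ vertices is *module-composed* if its vertices can be ordered as $u_1,\dots,u_n$ such that, for every $2\le i\le n$, the set $N(u_i)\cap\{u_1,\dots,u_{i-1}\}$ is a module of $G[\{u_1,\dots,u_{i-1}\}]$. For $U\subseteq V_G$ and $k\ge 0$ let $D_G(U,k)$ be the set of vertices at distance at most $k$ in $G$ from some vertex of $U$, and let $D_G(v,k)=D_G(\{v\},k)$. A vertex $v$ is *h-extremal* in $G$ if there is a proper subset $H\subsetneq D_G(v,2)$ that is a homogeneous set of $G$ and satisfies $D_G(v,2)\subseteq D_G(H,1)$. A *homogeneous ordering* of $G$ is an ordering $v_1,\dots,v_n$ of its vertices such that every $v_i$ which is not the last vertex of its connected component of $G$ is h-extremal in $G[\{v_i,\dots,v_n\}]$ (if $G$ is connected, this is required exactly for $1\le i\le n-1$). $G$ is *homogeneously orderable* if it has a homogeneous ordering. **Corollary.** Every module-composed graph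 is homogeneously orderable. -/

import Mathlib

namespace ModuleComposed

/-- A set `M` of vertices is a module (homogeneous set) of `G` if any two of its elements have the
same neighbours outside `M`. -/
def IsModule {V : Type*} (G : SimpleGraph V) (M : Set V) : Prop :=
  ∀ v₁ ∈ M, ∀ v₂ ∈ M, G.neighborSet v₁ \ M = G.neighborSet v₂ \ M

/-- `φ` is a module-sequence for `G`: for every vertex other than the first one, its neighbourhood
among the earlier vertices is a module of the subgraph induced by the earlier vertices.
(The positions are `0, …, |V| - 1`.) -/
def IsModuleSequence {V : Type*} [Fintype V] (G : SimpleGraph V)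
    (φ : V ≃ Fin (Fintype.card V)) : Prop :=
  ∀ i : Fin (Fintype.card V), 1 ≤ (i : ℕ) →
    IsModule (G.induce {w | φ w < i}) {w | G.Adj (φ.symm i) w}

/-- `G` is module-composed if it has a module-sequence. -/
def IsModuleComposed {V : Type*} [Fintype V] (G : SimpleGraph V) : Prop :=
  ∃ φ : V ≃ Fin (Fintype.card V), IsModuleSequence G φ

/-- The disk `D(U, k)`: all vertices at distance at most `k` from some vertex of `U`.
The extended distance is used, so vertices of other components are at distance `⊤`. -/
def disk {V : Type*} (G : SimpleGraph V) (U : Set V) (k : ℕ) : Set V :=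
  {w | ∃ u ∈ U, G.edist u w ≤ k}

/-- A vertex `v` is h-extremal in `G` if some proper subset `H` of `D(v, 2)` is homogeneous
in `G` and dominates `D(v, 2)`. -/
def IsHExtremal {V : Type*} (G : SimpleGraph V) (v : V) : Prop :=
  ∃ H : Set V, H ⊂ disk G {v} 2 ∧ IsModule G H ∧ disk G {v} 2 ⊆ disk G H 1

/-- `σ` is a homogeneous (h-extremal) ordering `(v₁, …, vₙ)` of `G`: each `vᵢ` that is not the last
vertex of its connected component of `G` is h-extremal in `G[{vᵢ, …, vₙ}]`. In a connected graph
these are the `vᵢ` with `i < n`. -/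
def IsHomogeneousOrdering {V : Type*} [Fintype V] (G : SimpleGraph V)
    (σ : V ≃ Fin (Fintype.card V)) : Prop :=
  ∀ v : V, (∃ w, σ v < σ w ∧ G.Reachable v w) →
    IsHExtremal (G.induce {w | σ v ≤ σ w}) ⟨v, le_refl (σ v)⟩

/-- `G` is homogeneously orderable if it has a homogeneous ordering. -/
def IsHomogeneouslyOrderable {V : Type*} [Fintype V] (G : SimpleGraph V) : Prop :=
  ∃ σ : V ≃ Fin (Fintype.card V), IsHomogeneousOrdering G σ

end ModuleComposed

namespace ModuleComposed

variable {V : Type*}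

/-! Eliminate vertices one at a time, keeping components connected. Let `u` be the `φ`-last vertex
left. If deleting `u` disconnects nothing, remove it: its neighbourhood is a module that dominates
the disk of radius two. Otherwise two neighbours `m`, `n` of `u` get separated; a vertex at distance
two from `u` would be adjacent to both, so `u` dominates its component, and `m` can be removed with
module `{u}`. This is `exists_removable`; `exists_ordering` iterates it. -/

/-- Connectivity by walks of `G` that stay inside `S`. -/
def ReachableIn (G : SimpleGraph V) (S : Set V) : V → V → Prop :=
  Relation.ReflTransGen fun x y => x ∈ S ∧ y ∈ S ∧ G.Adj x y

/-- Some nonempty set `H` of neighbours of `v` in `S` is a module of `G[S]` and dominates all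
vertices of `S` at distance one or two from `v`. -/
def HasDominatingModule (G : SimpleGraph V) (S : Set V) (v : V) : Prop :=
  ∃ H : Set V, H ⊆ S ∧ H.Nonempty ∧ (∀ h ∈ H, G.Adj v h) ∧
    (∀ a ∈ H, ∀ b ∈ H, ∀ x ∈ S, x ∉ H → G.Adj a x → G.Adj b x) ∧
    (∀ y ∈ S, G.Adj v y → y ∈ H ∨ ∃ h ∈ H, G.Adj h y) ∧
    (∀ y ∈ S, ∀ x ∈ S, G.Adj v y → G.Adj y x → x ∈ H ∨ ∃ h ∈ H, G.Adj h x)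

theorem eq_or_adj_or_exists_adj_of_edist_le_two {G : SimpleGraph V} {v w : V}
    (h : G.edist v w ≤ 2) : w = v ∨ G.Adj v w ∨ ∃ y, G.Adj v y ∧ G.Adj y w := by
  obtain ⟨p, hp⟩ := SimpleGraph.exists_walk_of_edist_ne_top
    (ne_top_of_le_ne_top (by decide : (2 : ℕ∞) ≠ ⊤) h)
  rw [← hp] at h
  have hl : p.length ≤ 2 := by exact_mod_cast h
  match p, hl with
  | .nil, _ => exact Or.inl rfl
  | .cons h₁ .nil, _ => exact Or.inr (Or.inl h₁)
  | .cons h₁ (.cons h₂ .nil), _ => exact Or.inr (Or.inr ⟨_, h₁, h₂⟩)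
  | .cons _ (.cons _ (.cons _ _)), hl => simp at hl

theorem edist_le_one_of_adj {G : SimpleGraph V} {v w : V} (h : G.Adj v w) :
    G.edist v w ≤ 1 :=
  (SimpleGraph.edist_eq_one_iff_adj.2 h).le

theorem HasDominatingModule.isHExtremal {G : SimpleGraph V} {S : Set V} {v : V} (hv : v ∈ S)
    (h : HasDominatingModule G S v) : IsHExtremal (G.induce S) ⟨v, hv⟩ := by
  obtain ⟨H, hHS, ⟨h₀, hh₀⟩, hadj, hmod, hdom₁, hdom₂⟩ := h
  refine ⟨{x | x.1 ∈ H}, ⟨?_, ?_⟩, ?_, ?_⟩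
  · intro x hx
    exact ⟨_, rfl, (edist_le_one_of_adj (G := G.induce S) (v := ⟨v, hv⟩) (w := x)
      (hadj _ hx)).trans (by decide)⟩
  · intro hsub
    have : v ∈ H := hsub (a := ⟨v, hv⟩) ⟨_, rfl, by simp⟩
    exact G.loopless.irrefl v (hadj v this)
  · intro a ha b hb
    ext x
    constructor
    · rintro ⟨hax, hx⟩
      exact ⟨hmod a ha b hb x x.2 hx hax, hx⟩
    · rintro ⟨hbx, hx⟩
      exact ⟨hmod b hb a ha x x.2 hx hbx, hx⟩
  · have key : ∀ x : S, (x.1 ∈ H ∨ ∃ h ∈ H, G.Adj h x.1) →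
        x ∈ disk (G.induce S) {x | x.1 ∈ H} 1 := by
      rintro x (hx | ⟨h, hh, hhx⟩)
      · exact ⟨x, hx, by simp⟩
      · exact ⟨⟨h, hHS hh⟩, hh, by
          simpa using edist_le_one_of_adj (G := G.induce S) (v := ⟨h, hHS hh⟩) (w := x) hhx⟩
    rintro x ⟨_, rfl, hx⟩
    apply key
    rcases eq_or_adj_or_exists_adj_of_edist_le_two hx with rfl | hx | ⟨y, hy, hyx⟩
    · exact Or.inr ⟨h₀, hh₀, (hadj _ hh₀).symm⟩
    · exact hdom₁ x x.2 hx
    · exact hdom₂ y y.2 x x.2 hy hyx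

/-- Deleting `v` keeps the connectivity of `S` if it keeps the neighbours of `v` connected. -/
theorem ReachableIn.diff_singleton {G : SimpleGraph V} {S : Set V} {v a b : V}
    (hN : ∀ p ∈ S, ∀ q ∈ S, G.Adj v p → G.Adj v q → ReachableIn G (S \ {v}) p q)
    (h : ReachableIn G S a b) (ha : a ≠ v) (hb : b ≠ v) : ReachableIn G (S \ {v}) a b := by
  -- Strengthened for induction: a walk that has arrived at `v` must already be able to reach every
  -- possible exit from `v`.
  suffices H : (b ≠ v → ReachableIn G (S \ {v}) a b) ∧
      (b = v → ∀ q ∈ S, G.Adj v q → ReachableIn G (S \ {v}) a q) from H.1 hb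
  clear hb
  induction h with
  | refl => exact ⟨fun _ => Relation.ReflTransGen.refl, fun h => absurd h ha⟩
  | @tail b c _ hbc ih =>
    obtain ⟨hbS, hcS, hadj⟩ := hbc
    by_cases hb : b = v
    · subst hb
      exact ⟨fun _ => ih.2 rfl c hcS hadj, fun hc => absurd hc hadj.ne'⟩
    · refine ⟨fun hc => (ih.1 hb).tail ⟨⟨hbS, hb⟩, ⟨hcS, hc⟩, hadj⟩, ?_⟩
      rintro rfl q hq hcq
      exact (ih.1 hb).trans (hN b hbS q hq hadj.symm hcq)

theorem ReachableIn.eq_of_isolated {G : SimpleGraph V} {S : Set V} {v w : V}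
    (hv : ∀ x ∈ S, ¬ G.Adj v x) (h : ReachableIn G S v w) : w = v := by
  induction h with
  | refl => rfl
  | tail _ hbc ih => exact absurd (ih ▸ hbc.2.2) (hv _ hbc.2.1)

theorem IsModuleSequence.adj_of_adj [Fintype V] {G : SimpleGraph V}
    {φ : V ≃ Fin (Fintype.card V)} (hφ : IsModuleSequence G φ) {u a b x : V}
    (ha : φ a < φ u) (hb : φ b < φ u) (hx : φ x < φ u) (hua : G.Adj u a) (hub : G.Adj u b)
    (hux : ¬ G.Adj u x) (hax : G.Adj a x) : G.Adj b x := by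
  have h := hφ (φ u) (Nat.succ_le_of_lt (lt_of_le_of_lt (Nat.zero_le _) ha))
    ⟨a, ha⟩ (by simpa using hua) ⟨b, hb⟩ (by simpa using hub)
  have hm : (⟨x, hx⟩ : {w | φ w < φ u}) ∈ (G.induce {w | φ w < φ u}).neighborSet ⟨a, ha⟩ \
      {w | G.Adj (φ.symm (φ u)) w} := ⟨hax, by simpa using hux⟩
  rw [h] at hm
  exact hm.1

/-- In a module-composed graph every nonempty vertex set `S` has a vertex that is isolated in
`G[S]` or has a dominating module, and whose deletion keeps the connectivity of `S`. -/
theorem IsModuleSequence.exists_removable [Fintype V] {G : SimpleGraph V}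
    {φ : V ≃ Fin (Fintype.card V)} (hφ : IsModuleSequence G φ) {S : Set V} (hS : S.Nonempty) :
    ∃ v ∈ S, ((∀ x ∈ S, ¬ G.Adj v x) ∨ HasDominatingModule G S v) ∧
      ∀ p ∈ S, ∀ q ∈ S, G.Adj v p → G.Adj v q → ReachableIn G (S \ {v}) p q := by
  obtain ⟨u, huS, hmax⟩ := Set.exists_max_image S φ S.toFinite hS
  have hlt : ∀ x ∈ S, x ≠ u → φ x < φ u := fun x hx hxu =>
    lt_of_le_of_ne (hmax x hx) (fun h => hxu (φ.injective h))
  have hmod : ∀ a ∈ S, ∀ b ∈ S, ∀ x ∈ S, G.Adj u a → G.Adj u b → x ≠ u → ¬ G.Adj u x →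
      G.Adj a x → G.Adj b x := fun a ha b hb x hx hua hub hxu =>
    hφ.adj_of_adj (hlt a ha hua.ne') (hlt b hb hub.ne') (hlt x hx hxu) hua hub
  by_cases hN : ∀ p ∈ S, ∀ q ∈ S, G.Adj u p → G.Adj u q → ReachableIn G (S \ {u}) p q
  · refine ⟨u, huS, ?_, hN⟩
    by_cases hiso : ∀ x ∈ S, ¬ G.Adj u x
    · exact Or.inl hiso
    · push Not at hiso
      obtain ⟨m, hmS, hum⟩ := hiso
      refine Or.inr ⟨{x | x ∈ S ∧ G.Adj u x}, fun x hx => hx.1, ⟨m, hmS, hum⟩,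
        fun x hx => hx.2, ?_, fun y hy huy => Or.inl ⟨hy, huy⟩,
        fun y hy x _ huy hyx => Or.inr ⟨y, ⟨hy, huy⟩, hyx⟩⟩
      intro a ha b hb x hx hxM hax
      by_cases hxu : x = u
      · exact hxu ▸ hb.2.symm
      · exact hmod a ha.1 b hb.1 x hx ha.2 hb.2 hxu (fun h => hxM ⟨hx, h⟩) hax
  · push Not at hN
    obtain ⟨m, hmS, n, hnS, hum, hun, hmn⟩ := hN
    -- `u` is adjacent to all other vertices of its component
    have hclosed : ∀ y ∈ S, ∀ x ∈ S, G.Adj u y → G.Adj y x → x = u ∨ G.Adj u x := by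
      intro y hy x hx huy hyx
      by_contra! hcon
      have hmx := hmod y hy m hmS x hx huy hum hcon.1 hcon.2 hyx
      have hnx := hmod y hy n hnS x hx huy hun hcon.1 hcon.2 hyx
      -- The path `m`, `x`, `n` avoids `u`.
      exact hmn (.tail (.single ⟨⟨hmS, hum.ne'⟩, ⟨hx, hcon.1⟩, hmx⟩)
        ⟨⟨hx, hcon.1⟩, ⟨hnS, hun.ne'⟩, hnx.symm⟩)
    have hdom : ∀ x, x = u ∨ G.Adj u x → x ∈ ({u} : Set V) ∨ ∃ h ∈ ({u} : Set V), G.Adj h x := by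
      rintro x (rfl | hx)
      · exact Or.inl rfl
      · exact Or.inr ⟨u, rfl, hx⟩
    refine ⟨m, hmS, Or.inr ⟨{u}, by simpa using huS, ⟨u, rfl⟩, ?_, ?_, ?_, ?_⟩, ?_⟩
    · rintro _ rfl
      exact hum.symm
    · rintro _ rfl _ rfl x _ _ h
      exact h
    · exact fun y hy hmy => hdom y (hclosed m hmS y hy hum hmy)
    · intro y hy x hx hmy hyx
      rcases hclosed m hmS y hy hum hmy with rfl | huy
      · exact hdom x (Or.inr hyx)
      · exact hdom x (hclosed y hy x hx huy hyx)
    · intro p hp q hq hmp hmq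
      have huS' : u ∈ S \ {m} := ⟨huS, hum.ne⟩
      refine Relation.ReflTransGen.trans (b := u) ?_ ?_
      · rcases hclosed m hmS p hp hum hmp with rfl | hup
        · exact Relation.ReflTransGen.refl
        · exact Relation.ReflTransGen.single ⟨⟨hp, hmp.ne'⟩, huS', hup.symm⟩
      · rcases hclosed m hmS q hq hum hmq with rfl | huq
        · exact Relation.ReflTransGen.refl
        · exact Relation.ReflTransGen.single ⟨huS', ⟨hq, hmq.ne'⟩, huq⟩

/-- An isolated vertex has no dominating module. Since deletions preserve connectivity, a vertex
becomes isolated only when it is the last of its original component, where nothing is required. -/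
theorem IsModuleSequence.exists_ordering [Fintype V] {G : SimpleGraph V}
    {φ : V ≃ Fin (Fintype.card V)} (hφ : IsModuleSequence G φ) (S : Set V) :
    ∃ f : V → ℕ, Set.InjOn f S ∧ ∀ v ∈ S, (∃ w ∈ S, f v < f w ∧ ReachableIn G S v w) →
      HasDominatingModule G {w | w ∈ S ∧ f v ≤ f w} v := by
  classical
  induction hn : S.ncard generalizing S with
  | zero =>
    rw [(Set.ncard_eq_zero S.toFinite).1 hn]
    exact ⟨fun _ => 0, by simp, by simp⟩
  | succ n ih =>
    obtain ⟨v, hvS, hv, hN⟩ := hφ.exists_removable (S := S)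
      ((Set.ncard_pos S.toFinite).1 (by omega))
    obtain ⟨f, hinj, hf⟩ := ih (S \ {v}) (by
      rw [Set.ncard_sdiff_singleton_of_mem hvS, hn, Nat.add_sub_cancel])
    -- The shift by one puts `v` strictly before the rest of `S`.
    refine ⟨fun w => if w = v then 0 else f w + 1, ?_, ?_⟩
    · intro a ha b hb hab
      by_cases hav : a = v <;> by_cases hbv : b = v <;> simp [hav, hbv] at hab ⊢
      exact hinj ⟨ha, hav⟩ ⟨hb, hbv⟩ hab
    · rintro x hx ⟨w, hw, hlt, hxw⟩
      have hwv : w ≠ v := by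
        rintro rfl
        simp at hlt
      by_cases hxv : x = v
      · subst hxv
        have hset : {w | w ∈ S ∧ (if x = x then 0 else f x + 1) ≤ if w = x then 0 else f w + 1}
            = S := by
          ext y
          simp
        rw [hset]
        exact hv.resolve_left fun hiso => hwv (hxw.eq_of_isolated hiso)
      · have hset : {w | w ∈ S ∧ (if x = v then 0 else f x + 1) ≤ if w = v then 0 else f w + 1}
            = {w | w ∈ S \ {v} ∧ f x ≤ f w} := by
          ext y
          by_cases hyv : y = v <;> simp [hxv, hyv]
        rw [hset]
        simp only [hxv, hwv, if_false] at hlt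
        exact hf x ⟨hx, hxv⟩ ⟨w, ⟨hw, hwv⟩, by omega, hxw.diff_singleton hN hxv hwv⟩

theorem exists_equiv_fin_of_injective [Fintype V] {f : V → ℕ} (hf : Function.Injective f) :
    ∃ σ : V ≃ Fin (Fintype.card V), ∀ a b, σ a ≤ σ b ↔ f a ≤ f b := by
  let _ : LinearOrder V := LinearOrder.lift' f hf
  let e := (Fintype.orderIsoFinOfCardEq V rfl).symm
  exact ⟨e.toEquiv, fun a b => e.le_iff_le⟩

end ModuleComposed

theorem mainTheorem7 {V : Type*} [Fintype V] (G : SimpleGraph V)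
    (hG : ModuleComposed.IsModuleComposed G) :
    ModuleComposed.IsHomogeneouslyOrderable G := by
  obtain ⟨φ, hφ⟩ := hG
  obtain ⟨f, hinj, hf⟩ := ModuleComposed.IsModuleSequence.exists_ordering hφ Set.univ
  obtain ⟨σ, hσ⟩ := ModuleComposed.exists_equiv_fin_of_injective (Set.injOn_univ.1 hinj)
  refine ⟨σ, ?_⟩
  rintro v ⟨w, hvw, hr⟩
  apply ModuleComposed.HasDominatingModule.isHExtremal
  have h := hf v (Set.mem_univ v) ⟨w, Set.mem_univ w,
    not_le.1 fun h => absurd ((hσ w v).2 h) (not_le.2 hvw), by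
      simpa [ModuleComposed.ReachableIn] using (SimpleGraph.reachable_iff_reflTransGen v w).1 hr⟩
  simpa [hσ] using h
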